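/- Let $q$ be a complex number with $|q|<1$. Put $[n]=(1-q^n)/(1-q)$, $(a;p)_n=\prod_{j=0}^{n-1}(1-ap^j)$ for integers $n\ge 0$ (so that $(a;p)_0=1$), and $(a;p)_\infty=\prod_{j=0}^{\infty}(1-ap^j)$ for $|p|<1$. Then the following three series converge absolutely and have the stated sums: $$\sum_{n=0}^\infty \frac{(-1)^n q^{2n^2}(q^2;q^4)_{n}^2(q;q^2)_{2n}}{(q^4;q^4)_{n}^2(q^4;q^4)_{2n}}\left([8n+1]+[4n+1]\frac{q^{4n+1}}{1+q^{4n+2}}\right)=\frac{(1+q)(q^2;q^4)_{\infty}(q^6;q^4)_{\infty}}{(q^4;q^4)_{\infty}^2},$$ $$\sum_{n=0}^\infty \frac{(-1)^n q^{2n^2}(q^2;q^4)_{n}(q^2;q^4)_{2n}(q;q^2)_{3n}}{(q^4;q^4)_{n}^2(q^4;q^4)_{3n}(q;q^2)_n}\left([10n+1]+\frac{q^{6n+1}[4n+2][6n+1]}{[12n+4]}+\frac{q^{6n+3}[6n+1][6n+3][8n+2](1+q^{2n+1})}{[12n+4][12n+8]}\right)=\frac{(1+q)(q^2;q^4)_{\infty}(q^6;q^4)_{\infty}}{(q^4;q^4)_{\infty}^2},$$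 $$\sum_{n=0}^\infty \frac{q^{4n^2}(q;q^2)_{2n}^2}{(q^4;q^4)_{n}^2(q^4;q^4)_{2n}}\left([8n+1]-q^{8n+3}\frac{[4n+1]^2}{[8n+4]}\right)=\frac{(q^3;q^4)_\infty (q^5;q^4)_\infty}{(q^4;q^4)_\infty^2}.$$ -/

import Mathlib

/-- The finite `q`-Pochhammer symbol `(a; q)_n = ∏_{j=0}^{n-1} (1 - a q^j)`. -/
noncomputable def qPoch (a q : ℂ) (n : ℕ) : ℂ :=
  ∏ j ∈ Finset.range n, (1 - a * q ^ j)

/-- The infinite `q`-Pochhammer symbol `(a; q)_∞ = ∏_{j=0}^∞ (1 - a q^j)`. -/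
noncomputable def qPochInf (a q : ℂ) : ℂ :=
  ∏' j : ℕ, (1 - a * q ^ j)

/-- The `q`-number `[n] = [n]_q = (1 - q^n) / (1 - q)`. -/
noncomputable def qNum (q : ℂ) (n : ℕ) : ℂ :=
  (1 - q ^ n) / (1 - q)

/-- The infinite product that defines `(a; q)_∞` converges for `|q| < 1`. -/
theorem qPochInf_hasProd (a : ℂ) {q : ℂ} (hq : ‖q‖ < 1) :
    HasProd (fun j : ℕ => 1 - a * q ^ j) (qPochInf a q) := by
  have hs : Summable (fun j : ℕ => ‖-(a * q ^ j)‖) := by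
    simp only [norm_neg, norm_mul, norm_pow]
    exact (summable_geometric_of_lt_one (norm_nonneg q) hq).mul_left ‖a‖
  have h := multipliable_one_add_of_summable hs
  simp only [← sub_eq_add_neg] at h
  exact h.hasProd

/-!
All three series are sums of a closed discrete one-form on the lattice `ℕ × ℕ` along a staircase
that goes to infinity, and the three evaluations are instances of path independence.

A one-form assigns `F n m` to the horizontal edge `(n, m) → (n + 1, m)` and `G n m` to the vertical
edge `(n, m) → (n, m + 1)`; it is closed if `F n (m + 1) - F n m = G (n + 1) m - G n m`, which is
the Wilf–Zeilberger relation.  If `G` vanishes for `n = 0` and both parts decay geometrically in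
`n`, the sum along the staircase whose `n`-th step goes from `(n, s n)` to `(n + 1, s (n + 1))` does
not change when the staircase is translated upwards.  If moreover `G n m → 0` as `m → ∞`, letting
the translation tend to infinity gives `∑ n, lim F n m` by dominated convergence.  This is
`hasSum_staircase`.

* `SlopeForm`: with `p = q ^ 4` and
  `W n m = (-1) ^ n q ^ (2 n ^ 2) (q ^ 2; p)_n (q ^ 2; p)_m (q; q ^ 2)_{n + m}
    / ((p; p)_n ^ 2 (p; p)_{n + m} (q; q ^ 2)_{m - n})`,
  the form with `F n m = W n m [6 n + 2 m + 1]` is closed on the region `n < m`.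
  Slopes `1` and `2` give the first and the second series, which is why their sums agree.
  As `m → ∞` both become a multiple of `∑ (-1) ^ n q ^ (2 n ^ 2) (q ^ 2; p)_n / (p; p)_n ^ 2`.
* `GaussForm`: that series is in turn the sum of a closed form along the line `m = 0` (slope `0`);
  here only the term `n = 0` survives in the limit.
* `SymmForm`: the third series is the slope-`1` sum of a form symmetric in `n` and `m`, again with
  only the term `n = 0` surviving.

The finite symbols `(q ^ k; q ^ l)_n` and their reciprocals are bounded in `n`, since the infinite
products converge to nonzero limits; all dominations come from the remaining powers of `q`.
-/

open Filter Topology Asymptotics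

/-! ### Finite and infinite `q`-Pochhammer symbols -/

theorem qPoch_zero (a q : ℂ) : qPoch a q 0 = 1 := by simp [qPoch]

theorem qPoch_succ (a q : ℂ) (n : ℕ) : qPoch a q (n + 1) = qPoch a q n * (1 - a * q ^ n) :=
  Finset.prod_range_succ _ _

theorem qPoch_two_mul (a q : ℂ) (n : ℕ) :
    qPoch a q (2 * n) = qPoch a (q ^ 2) n * qPoch (a * q) (q ^ 2) n := by
  induction n with
  | zero => simp [qPoch_zero]
  | succ n ih =>
    rw [show 2 * (n + 1) = 2 * n + 1 + 1 by ring]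
    simp only [qPoch_succ, ih]
    ring

theorem one_sub_pow_ne_zero {q : ℂ} (hq : ‖q‖ < 1) {n : ℕ} (hn : n ≠ 0) : 1 - q ^ n ≠ 0 := by
  intro h
  have h1 : ‖q ^ n‖ < 1 := by
    rw [norm_pow]
    exact pow_lt_one₀ (norm_nonneg q) hq hn
  rw [← sub_eq_zero.mp h, norm_one] at h1
  exact lt_irrefl _ h1

theorem one_sub_pow_mul_pow_ne_zero {q : ℂ} (hq : ‖q‖ < 1) {k : ℕ} (hk : k ≠ 0) (l j : ℕ) :
    1 - q ^ k * (q ^ l) ^ j ≠ 0 := by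
  rw [← pow_mul, ← pow_add]
  exact one_sub_pow_ne_zero hq (by omega)

theorem qPoch_ne_zero {q : ℂ} (hq : ‖q‖ < 1) {k : ℕ} (hk : k ≠ 0) (l n : ℕ) :
    qPoch (q ^ k) (q ^ l) n ≠ 0 :=
  Finset.prod_ne_zero_iff.mpr fun j _ => one_sub_pow_mul_pow_ne_zero hq hk l j

theorem tendsto_qPoch (a : ℂ) {q : ℂ} (hq : ‖q‖ < 1) :
    Tendsto (qPoch a q) atTop (𝓝 (qPochInf a q)) :=
  (qPochInf_hasProd a hq).tendsto_prod_nat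

theorem norm_pow_lt_one {q : ℂ} (hq : ‖q‖ < 1) {l : ℕ} (hl : l ≠ 0) : ‖q ^ l‖ < 1 := by
  rw [norm_pow]
  exact pow_lt_one₀ (norm_nonneg q) hq hl

theorem qPochInf_ne_zero {q : ℂ} (hq : ‖q‖ < 1) {k l : ℕ} (hk : k ≠ 0) (hl : l ≠ 0) :
    qPochInf (q ^ k) (q ^ l) ≠ 0 := by
  have hs : Summable (fun j : ℕ => ‖-(q ^ k * (q ^ l) ^ j)‖) := by
    simp only [norm_neg, norm_mul, norm_pow _ (_ : ℕ)]
    refine (summable_geometric_of_lt_one (by positivity) ?_).mul_left _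
    exact pow_lt_one₀ (norm_nonneg q) hq hl
  have h := tprod_one_add_ne_zero_of_summable (f := fun j : ℕ => -(q ^ k * (q ^ l) ^ j))
    (fun j => by
      rw [← sub_eq_add_neg]
      exact one_sub_pow_mul_pow_ne_zero hq hk l j) hs
  simpa only [qPochInf, sub_eq_add_neg] using h

theorem qPochInf_eq_mul (a : ℂ) {q : ℂ} (hq : ‖q‖ < 1) :
    qPochInf a q = (1 - a) * qPochInf (a * q) q := by
  have h1 : Tendsto (fun n => qPoch a q (n + 1)) atTop (𝓝 (qPochInf a q)) :=
    (tendsto_qPoch a hq).comp (tendsto_add_atTop_nat 1)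
  have h2 := (tendsto_qPoch (a * q) hq).const_mul (1 - a)
  refine tendsto_nhds_unique h1 (h2.congr fun n => ?_)
  simp only [qPoch, Finset.prod_range_succ' _ n, pow_zero, mul_one]
  rw [mul_comm]
  congr 1
  exact Finset.prod_congr rfl fun j _ => by ring

/-- The recurrence with the exponent of the new factor collected, so that it is linear in `n`. -/
theorem qPoch_pow_succ (q : ℂ) (k l n : ℕ) :
    qPoch (q ^ k) (q ^ l) (n + 1) = qPoch (q ^ k) (q ^ l) n * (1 - q ^ (k + l * n)) := by
  rw [qPoch_succ, ← pow_mul, ← pow_add]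

theorem qPoch_self_pow_succ (q : ℂ) (l n : ℕ) :
    qPoch q (q ^ l) (n + 1) = qPoch q (q ^ l) n * (1 - q ^ (1 + l * n)) := by
  simpa using qPoch_pow_succ q 1 l n

theorem tendsto_qPoch_add (a : ℂ) {q : ℂ} (hq : ‖q‖ < 1) (n : ℕ) :
    Tendsto (fun m => qPoch a q (n + m)) atTop (𝓝 (qPochInf a q)) :=
  (tendsto_qPoch a hq).comp (tendsto_atTop_mono (fun m => Nat.le_add_left m n) tendsto_id)

/-! ### Uniform bounds -/

/-- A convergent sequence, read along any index map, is bounded. -/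
theorem isBigO_one_of_tendsto {u : ℕ → ℂ} {c : ℂ} (h : Tendsto u atTop (𝓝 c))
    {α : Type*} (g : α → ℕ) : (fun x => u (g x)) =O[⊤] (fun _ => (1 : ℝ)) := by
  obtain ⟨C, hC⟩ := (Metric.isBounded_range_of_tendsto u h).exists_norm_le
  exact isBigO_top.mpr ⟨C, fun x => by simpa using hC (u (g x)) ⟨g x, rfl⟩⟩

theorem isBigO_qPoch (a : ℂ) {q : ℂ} (hq : ‖q‖ < 1) {α : Type*} (g : α → ℕ) :
    (fun x => qPoch a q (g x)) =O[⊤] (fun _ => (1 : ℝ)) :=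
  isBigO_one_of_tendsto (tendsto_qPoch a hq) g

/-- The reciprocals `1 / (q ^ k; q ^ l)_n` stay bounded because the infinite product is nonzero. -/
theorem isBigO_qPoch_inv {q : ℂ} (hq : ‖q‖ < 1) {k l : ℕ} (hk : k ≠ 0) (hl : l ≠ 0)
    {α : Type*} (g : α → ℕ) :
    (fun x => (qPoch (q ^ k) (q ^ l) (g x))⁻¹) =O[⊤] (fun _ => (1 : ℝ)) :=
  isBigO_one_of_tendsto (u := fun n => (qPoch (q ^ k) (q ^ l) n)⁻¹)
    ((tendsto_qPoch _ (norm_pow_lt_one hq hl)).inv₀ (qPochInf_ne_zero hq hk hl)) g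

theorem tendsto_pow_of_tendsto_atTop {q : ℂ} (hq : ‖q‖ < 1) {e : ℕ → ℕ}
    (he : Tendsto e atTop atTop) : Tendsto (fun m => q ^ e m) atTop (𝓝 0) :=
  (tendsto_pow_atTop_nhds_zero_of_norm_lt_one hq).comp he

theorem isBigO_pow {q : ℂ} (hq : ‖q‖ < 1) {α : Type*} (g : α → ℕ) :
    (fun x => q ^ g x) =O[⊤] (fun _ => (1 : ℝ)) :=
  isBigO_one_of_tendsto (tendsto_pow_atTop_nhds_zero_of_norm_lt_one hq) g

theorem isBigO_one_sub_pow {q : ℂ} (hq : ‖q‖ < 1) {α : Type*} (g : α → ℕ) :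
    (fun x => 1 - q ^ g x) =O[⊤] (fun _ => (1 : ℝ)) :=
  (isBigO_const_const (1 : ℂ) one_ne_zero ⊤).sub (isBigO_pow hq g)

theorem tendsto_one_sub_pow {q : ℂ} (hq : ‖q‖ < 1) {e : ℕ → ℕ}
    (he : Tendsto e atTop atTop) : Tendsto (fun m => 1 - q ^ e m) atTop (𝓝 1) := by
  simpa using (tendsto_pow_of_tendsto_atTop hq he).const_sub 1

/-- A bounded function times a power of `q` whose exponent is at least `n` decays geometrically in
`n`. -/
theorem exists_geometric_bound {q : ℂ} (hq : ‖q‖ < 1) {f : ℕ × ℕ → ℂ}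
    (hf : f =O[⊤] (fun _ => (1 : ℝ))) (e : ℕ → ℕ → ℕ) :
    ∃ C, ∀ n m, n ≤ e n m → ‖q ^ e n m * f (n, m)‖ ≤ C * ‖q‖ ^ n := by
  obtain ⟨C, hC⟩ := isBigO_top.mp hf
  refine ⟨C, fun n m h => ?_⟩
  rw [norm_mul, norm_pow, mul_comm]
  refine mul_le_mul (by simpa using hC (n, m))
    (pow_le_pow_of_le_one (norm_nonneg q) hq.le h) (by positivity) ?_
  simpa using (norm_nonneg _).trans (hC (n, m))

/-! ### Path independence -/

/-- Summation of a closed discrete one-form along a staircase of slope `s`.  The form is `F` on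
horizontal edges `(n, m) → (n + 1, m)` and `G` on vertical edges `(n, m) → (n, m + 1)`; the `n`-th
step goes up first and then right.  Only the region on and above the staircase matters.
Translating the staircase vertically by one step changes its sum by boundary values of `G` only,
which vanish; translating it to infinity replaces each step by `lim F n m`. -/
theorem hasSum_staircase {q : ℂ} (hq : ‖q‖ < 1) {F G : ℕ → ℕ → ℂ} (s : ℕ) {L : ℕ → ℂ}
    (hclosed : ∀ n m, s * (n + 1) ≤ m → F n (m + 1) - F n m = G (n + 1) m - G n m)
    (hG₀ : ∀ m, G 0 m = 0)
    (hFb : ∃ C, ∀ n m, s * n ≤ m → ‖F n m‖ ≤ C * ‖q‖ ^ n)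
    (hGb : ∃ C, ∀ n m, s * n ≤ m → ‖G n m‖ ≤ C * ‖q‖ ^ n)
    (hFL : ∀ n, Tendsto (F n) atTop (𝓝 (L n))) (hGL : ∀ n, Tendsto (G n) atTop (𝓝 0)) :
    HasSum (fun n => F n (s * (n + 1)) + ∑ i ∈ Finset.range s, G n (s * n + i)) (∑' n, L n) := by
  obtain ⟨C₁, hC₁⟩ := hFb
  obtain ⟨C₂, hC₂⟩ := hGb
  set b : ℕ → ℝ := fun n => max C₁ C₂ * ‖q‖ ^ n
  have hb : Summable b := (summable_geometric_of_lt_one (norm_nonneg q) hq).mul_left _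
  have hF : ∀ n m, s * n ≤ m → ‖F n m‖ ≤ b n := fun n m h =>
    (hC₁ n m h).trans (mul_le_mul_of_nonneg_right (le_max_left _ _) (by positivity))
  have hG : ∀ n m, s * n ≤ m → ‖G n m‖ ≤ b n := fun n m h =>
    (hC₂ n m h).trans (mul_le_mul_of_nonneg_right (le_max_right _ _) (by positivity))
  -- `E d n` is the `n`-th step of the staircase translated upwards by `d`.
  set E : ℕ → ℕ → ℂ := fun d n =>
    F n (s * (n + 1) + d) + ∑ i ∈ Finset.range s, G n (s * n + d + i) with hE
  have hEb : ∀ d n, ‖E d n‖ ≤ b n + s * b n := by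
    intro d n
    refine (norm_add_le _ _).trans (add_le_add (hF _ _ (by nlinarith)) ?_)
    refine (norm_sum_le_of_le (Finset.range s)
      (f := fun i => G n (s * n + d + i)) (n := fun _ => b n)
      fun i _ => hG _ _ (by omega)).trans ?_
    simp
  have hEs : Summable (fun n => b n + s * b n) := hb.add (hb.mul_left _)
  have hsum : ∀ d, Summable (E d) := fun d => Summable.of_norm_bounded hEs (hEb d)
  have hstep : ∀ d n, E (d + 1) n - E d n = G (n + 1) (s * (n + 1) + d) - G n (s * n + d) := by
    intro d n
    have h1 := hclosed n (s * (n + 1) + d) (by omega)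
    have h2 := Finset.sum_range_succ (fun i => G n (s * n + d + i)) s
    rw [Finset.sum_range_succ'] at h2
    have h3 : s * n + d + s = s * (n + 1) + d := by ring
    rw [h3, add_zero] at h2
    have h4 : ∀ i, s * n + (d + 1) + i = s * n + d + (i + 1) := fun i => by ring
    simp only [hE, h4]
    rw [← add_assoc (s * (n + 1))]
    linear_combination h1 + h2
  have hconst : ∀ d, ∑' n, E (d + 1) n = ∑' n, E d n := by
    intro d
    rw [← sub_eq_zero, ← (hsum (d + 1)).tsum_sub (hsum d)]
    have h1 := ((hsum (d + 1)).sub (hsum d)).hasSum.tendsto_sum_nat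
    refine tendsto_nhds_unique h1 ?_
    simp only [hstep, Finset.sum_range_sub (fun n => G n (s * n + d)), hG₀, sub_zero]
    exact squeeze_zero_norm (fun n => hG n _ (by omega)) hb.tendsto_atTop_zero
  have hconst' : ∀ d, ∑' n, E d n = ∑' n, E 0 n := by
    intro d
    induction d with
    | zero => rfl
    | succ d ih => rw [hconst, ih]
  have hlim : Tendsto (fun d => ∑' n, E d n) atTop (𝓝 (∑' n, L n)) := by
    refine tendsto_tsum_of_dominated_convergence hEs (fun n => ?_)
      (Eventually.of_forall fun d => hEb d)
    have h1 : Tendsto (fun d => F n (s * (n + 1) + d)) atTop (𝓝 (L n)) :=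
      (hFL n).comp (tendsto_atTop_mono (fun d => Nat.le_add_left _ _) tendsto_id)
    have h2 : Tendsto (fun d => ∑ i ∈ Finset.range s, G n (s * n + d + i)) atTop (𝓝 0) := by
      rw [← Finset.sum_const_zero (s := Finset.range s)]
      refine tendsto_finsetSum _ fun i _ => (hGL n).comp ?_
      exact tendsto_atTop_mono (fun d => by simp only [id]; omega) tendsto_id
    simpa using h1.add h2
  have h0 := (hsum 0).hasSum
  rw [tendsto_nhds_unique hlim (tendsto_const_nhds.congr fun d => (hconst' d).symm)]
  exact h0

/-! ### A limiting case of the `q`-Gauss sum -/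

namespace GaussForm

/-- Horizontal part of the closed form whose sum along `m = 0` is the `q`-Gauss type series. -/
noncomputable def horiz (q : ℂ) (n m : ℕ) : ℂ :=
  (-1) ^ n * q ^ (2 * n ^ 2 + 4 * n * m) * qPoch (q ^ 2) (q ^ 4) n * qPoch (q ^ 2) (q ^ 4) m /
    (qPoch (q ^ 4) (q ^ 4) n * qPoch (q ^ 4) (q ^ 4) (n + m))

/-- Vertical part of the closed form for the `q`-Gauss type series. -/
noncomputable def vert (q : ℂ) (n m : ℕ) : ℂ := horiz q n m * (1 - q ^ (4 * n))

theorem closed {q : ℂ} (hq : ‖q‖ < 1) (n m : ℕ) :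
    horiz q n (m + 1) - horiz q n m = vert q (n + 1) m - vert q n m := by
  have e1 : n + (m + 1) = n + m + 1 := by ring
  have e2 : n + 1 + m = n + m + 1 := by ring
  simp only [horiz, vert, e1, e2]
  simp only [qPoch_pow_succ]
  have hn := qPoch_ne_zero hq four_ne_zero 4 n
  have hm := qPoch_ne_zero hq four_ne_zero 4 (n + m)
  have k1 : 1 - q ^ (4 + 4 * n) ≠ 0 := one_sub_pow_ne_zero hq (by omega)
  have k2 : 1 - q ^ (4 + 4 * (n + m)) ≠ 0 := one_sub_pow_ne_zero hq (by omega)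
  have e3 : q ^ (2 * n ^ 2 + 4 * n * (m + 1)) = q ^ (2 * n ^ 2 + 4 * n * m) * (q ^ n) ^ 4 := by
    ring
  have e4 : q ^ (2 * (n + 1) ^ 2 + 4 * (n + 1) * m) =
      q ^ (2 * n ^ 2 + 4 * n * m) * (q ^ n) ^ 4 * (q ^ m) ^ 4 * q ^ 2 := by ring
  rw [e3, e4, pow_succ (-1 : ℂ) n]
  -- `field_simp` treats the denominators as atoms; their values enter only in the final `ring`.
  generalize hu1 : 1 - q ^ (4 + 4 * n) = u1 at *
  generalize hu2 : 1 - q ^ (4 + 4 * (n + m)) = u2 at *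
  field_simp
  simp only [← hu1, ← hu2]
  simp only [pow_add, mul_add, pow_mul', mul_one]
  ring

theorem horiz_eq (q : ℂ) (n m : ℕ) : horiz q n m = q ^ (2 * n ^ 2 + 4 * n * m) *
    ((-1) ^ n * qPoch (q ^ 2) (q ^ 4) n * qPoch (q ^ 2) (q ^ 4) m *
      (qPoch (q ^ 4) (q ^ 4) n)⁻¹ * (qPoch (q ^ 4) (q ^ 4) (n + m))⁻¹) := by
  rw [horiz, div_eq_mul_inv, mul_inv]
  ring

theorem tendsto_horiz {q : ℂ} (hq : ‖q‖ < 1) (n : ℕ) : Tendsto (horiz q n) atTop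
    (𝓝 (if n = 0 then qPochInf (q ^ 2) (q ^ 4) / qPochInf (q ^ 4) (q ^ 4) else 0)) := by
  have hp : ‖q ^ 4‖ < 1 := norm_pow_lt_one hq four_ne_zero
  have h1 := (tendsto_qPoch (q ^ 2) hp).div (tendsto_qPoch_add (q ^ 4) hp n)
    (qPochInf_ne_zero hq four_ne_zero four_ne_zero)
  rcases eq_or_ne n 0 with rfl | hn
  · rw [if_pos rfl]
    refine h1.congr fun m => ?_
    simp [horiz, qPoch_zero]
  · rw [if_neg hn]
    have h2 : Tendsto (fun m => q ^ (2 * n ^ 2 + 4 * n * m)) atTop (𝓝 0) := by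
      refine tendsto_pow_of_tendsto_atTop hq (tendsto_atTop_mono (fun m => ?_) tendsto_id)
      simp only [id]
      nlinarith [Nat.pos_of_ne_zero hn]
    have h3 := (h2.mul h1).const_mul
      ((-1) ^ n * qPoch (q ^ 2) (q ^ 4) n / qPoch (q ^ 4) (q ^ 4) n)
    rw [zero_mul, mul_zero] at h3
    refine h3.congr fun m => ?_
    simp only [horiz, Pi.div_apply]
    ring

/-- Boundedness of all factors of `horiz` other than the power of `q`, see `horiz_eq`. -/
theorem isBigO_factor {q : ℂ} (hq : ‖q‖ < 1) :
    (fun x : ℕ × ℕ => (-1) ^ x.1 * qPoch (q ^ 2) (q ^ 4) x.1 * qPoch (q ^ 2) (q ^ 4) x.2 *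
      (qPoch (q ^ 4) (q ^ 4) x.1)⁻¹ * (qPoch (q ^ 4) (q ^ 4) (x.1 + x.2))⁻¹) =O[⊤]
      (fun _ => (1 : ℝ)) := by
  have hp : ‖q ^ 4‖ < 1 := norm_pow_lt_one hq four_ne_zero
  have h0 : (fun x : ℕ × ℕ => (-1 : ℂ) ^ x.1) =O[⊤] (fun _ => (1 : ℝ)) :=
    isBigO_top.mpr ⟨1, fun x => by simp⟩
  simpa using (((h0.mul (isBigO_qPoch (q ^ 2) hp fun x => x.1)).mul
    (isBigO_qPoch (q ^ 2) hp fun x => x.2)).mul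
    (isBigO_qPoch_inv hq four_ne_zero four_ne_zero fun x => x.1)).mul
    (isBigO_qPoch_inv hq four_ne_zero four_ne_zero fun x => x.1 + x.2)

/-- The limit `b → ∞` of the `q`-Gauss sum `₂φ₁(a, b; c; c / (a b))`, in base `q ^ 4` with
`a = q ^ 2` and `c = q ^ 4`. -/
theorem tsum_qPoch_div_sq {q : ℂ} (hq : ‖q‖ < 1) :
    ∑' n : ℕ, (-1) ^ n * q ^ (2 * n ^ 2) * qPoch (q ^ 2) (q ^ 4) n / qPoch (q ^ 4) (q ^ 4) n ^ 2
      = qPochInf (q ^ 2) (q ^ 4) / qPochInf (q ^ 4) (q ^ 4) := by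
  have h := hasSum_staircase hq (F := horiz q) (G := vert q) 0 (fun n m _ => closed hq n m)
    (fun m => by simp [vert]) ?_ ?_ (tendsto_horiz hq) (fun n => ?_)
  · rw [tsum_ite_eq] at h
    rw [← h.tsum_eq]
    refine tsum_congr fun n => ?_
    simp [horiz, qPoch_zero, sq]
  · obtain ⟨C, hC⟩ := exists_geometric_bound hq (isBigO_factor hq)
      (fun n m => 2 * n ^ 2 + 4 * n * m)
    exact ⟨C, fun n m _ => by rw [horiz_eq]; exact hC n m (by nlinarith)⟩
  · obtain ⟨C, hC⟩ := exists_geometric_bound hq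
      (((isBigO_factor hq).mul (isBigO_one_sub_pow hq fun x => 4 * x.1)).congr_right
        fun _ => one_mul 1)
      (fun n m => 2 * n ^ 2 + 4 * n * m)
    exact ⟨C, fun n m _ => by
      rw [vert, horiz_eq, mul_assoc]; exact hC n m (by nlinarith)⟩
  · refine ((tendsto_horiz hq n).mul_const (1 - q ^ (4 * n))).trans (le_of_eq ?_)
    rcases eq_or_ne n 0 with rfl | hn
    · simp
    · simp [hn]

end GaussForm

/-! ### The symmetric form and the third series -/

namespace SymmForm

/-- The common weight, symmetric in `n` and `m`. -/
noncomputable def weight (q : ℂ) (n m : ℕ) : ℂ :=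
  q ^ (4 * n * m) * (qPoch q (q ^ 4) n * qPoch (q ^ 3) (q ^ 4) n) *
    (qPoch q (q ^ 4) m * qPoch (q ^ 3) (q ^ 4) m) /
    (qPoch (q ^ 4) (q ^ 4) n * qPoch (q ^ 4) (q ^ 4) m * qPoch (q ^ 4) (q ^ 4) (n + m))

/-- Horizontal part of the symmetric form; it vanishes for `m = 0`. -/
noncomputable def horiz (q : ℂ) (n m : ℕ) : ℂ := weight q n m * qNum q (4 * m)

/-- Vertical part of the symmetric form; it vanishes for `n = 0`. -/
noncomputable def vert (q : ℂ) (n m : ℕ) : ℂ := weight q n m * qNum q (4 * n)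

theorem closed {q : ℂ} (hq : ‖q‖ < 1) (n m : ℕ) :
    horiz q n (m + 1) - horiz q n m = vert q (n + 1) m - vert q n m := by
  have e1 : n + (m + 1) = n + m + 1 := by ring
  have e2 : n + 1 + m = n + m + 1 := by ring
  simp only [horiz, vert, weight, qNum, e1, e2]
  simp only [qPoch_pow_succ, qPoch_self_pow_succ]
  have hn := qPoch_ne_zero hq four_ne_zero 4 n
  have hm := qPoch_ne_zero hq four_ne_zero 4 m
  have hnm := qPoch_ne_zero hq four_ne_zero 4 (n + m)
  have k0 : 1 - q ≠ 0 := by simpa using one_sub_pow_ne_zero hq one_ne_zero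
  have k1 : 1 - q ^ (4 + 4 * n) ≠ 0 := one_sub_pow_ne_zero hq (by omega)
  have k2 : 1 - q ^ (4 + 4 * (n + m)) ≠ 0 := one_sub_pow_ne_zero hq (by omega)
  have k3 : 1 - q ^ (4 + 4 * m) ≠ 0 := one_sub_pow_ne_zero hq (by omega)
  have e3 : q ^ (4 * n * (m + 1)) = q ^ (4 * n * m) * (q ^ n) ^ 4 := by ring
  have e4 : q ^ (4 * (n + 1) * m) = q ^ (4 * n * m) * (q ^ m) ^ 4 := by ring
  rw [e3, e4]
  generalize q ^ (4 * n * m) = a at *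
  generalize hu0 : 1 - q = u0 at *
  generalize hu1 : 1 - q ^ (4 + 4 * n) = u1 at *
  generalize hu2 : 1 - q ^ (4 + 4 * (n + m)) = u2 at *
  generalize hu3 : 1 - q ^ (4 + 4 * m) = u3 at *
  field_simp
  simp only [← hu1, ← hu2, ← hu3]
  simp only [pow_add, mul_add, pow_mul', pow_one, mul_one]
  ring

theorem tendsto_weight {q : ℂ} (hq : ‖q‖ < 1) (n : ℕ) : Tendsto (weight q n) atTop
    (𝓝 (if n = 0 then qPochInf q (q ^ 4) * qPochInf (q ^ 3) (q ^ 4) /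
      qPochInf (q ^ 4) (q ^ 4) ^ 2 else 0)) := by
  have hp : ‖q ^ 4‖ < 1 := norm_pow_lt_one hq four_ne_zero
  have hz := qPochInf_ne_zero hq four_ne_zero four_ne_zero
  have h1 := ((tendsto_qPoch q hp).mul (tendsto_qPoch (q ^ 3) hp)).div
    ((tendsto_qPoch (q ^ 4) hp).mul (tendsto_qPoch_add (q ^ 4) hp n)) (mul_ne_zero hz hz)
  rcases eq_or_ne n 0 with rfl | hn
  · rw [if_pos rfl, sq]
    refine h1.congr fun m => ?_
    simp [weight, qPoch_zero]
  · rw [if_neg hn]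
    have h2 : Tendsto (fun m => q ^ (4 * n * m)) atTop (𝓝 0) := by
      refine tendsto_pow_of_tendsto_atTop hq (tendsto_atTop_mono (fun m => ?_) tendsto_id)
      simp only [id]
      nlinarith [Nat.pos_of_ne_zero hn]
    have h3 := (h2.mul h1).const_mul
      (qPoch q (q ^ 4) n * qPoch (q ^ 3) (q ^ 4) n / qPoch (q ^ 4) (q ^ 4) n)
    rw [zero_mul, mul_zero] at h3
    refine h3.congr fun m => ?_
    simp only [weight, Pi.div_apply]
    ring

/-- Boundedness of all factors of the form other than `q ^ (4 n m)`. -/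
theorem isBigO_factor {q : ℂ} (hq : ‖q‖ < 1) (g : ℕ × ℕ → ℕ) :
    (fun x : ℕ × ℕ => qPoch q (q ^ 4) x.1 * qPoch (q ^ 3) (q ^ 4) x.1 *
      (qPoch q (q ^ 4) x.2 * qPoch (q ^ 3) (q ^ 4) x.2) *
      ((qPoch (q ^ 4) (q ^ 4) x.1)⁻¹ * (qPoch (q ^ 4) (q ^ 4) x.2)⁻¹ *
        (qPoch (q ^ 4) (q ^ 4) (x.1 + x.2))⁻¹) * (1 - q ^ g x)) =O[⊤]
      (fun _ => (1 : ℝ)) := by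
  have hp : ‖q ^ 4‖ < 1 := norm_pow_lt_one hq four_ne_zero
  simpa using ((((isBigO_qPoch q hp fun x => x.1).mul
    (isBigO_qPoch (q ^ 3) hp fun x => x.1)).mul
    ((isBigO_qPoch q hp fun x => x.2).mul (isBigO_qPoch (q ^ 3) hp fun x => x.2))).mul
    (((isBigO_qPoch_inv hq four_ne_zero four_ne_zero fun x => x.1).mul
    (isBigO_qPoch_inv hq four_ne_zero four_ne_zero fun x => x.2)).mul
    (isBigO_qPoch_inv hq four_ne_zero four_ne_zero fun x => x.1 + x.2))).mul
    (isBigO_one_sub_pow hq g)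

/-- The restriction `n ≤ m` is needed: `q ^ (4 n m)` does not decay in `n` when `m = 0`. -/
theorem exists_bound {q : ℂ} (hq : ‖q‖ < 1) (g : ℕ × ℕ → ℕ) :
    ∃ C, ∀ n m, n ≤ m → ‖weight q n m * qNum q (g (n, m))‖ ≤ C * ‖q‖ ^ n := by
  obtain ⟨C, hC⟩ := exists_geometric_bound hq
    ((isBigO_factor hq g).const_mul_left (1 - q)⁻¹) (fun n m => 4 * n * m)
  refine ⟨C, fun n m h => ?_⟩
  have h1 : n ≤ 4 * n * m := by
    rcases Nat.eq_zero_or_pos n with rfl | hn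
    · simp
    · nlinarith
  refine le_of_eq_of_le ?_ (hC n m h1)
  congr 1
  simp only [weight, qNum, div_eq_mul_inv, mul_inv]
  ring

/-- One step of the diagonal staircase is a term of the third series. -/
theorem step_eq {q : ℂ} (hq : ‖q‖ < 1) (n : ℕ) : horiz q n (n + 1) + vert q n n =
    q ^ (4 * n ^ 2) * qPoch q (q ^ 2) (2 * n) ^ 2
      / (qPoch (q ^ 4) (q ^ 4) n ^ 2 * qPoch (q ^ 4) (q ^ 4) (2 * n))
      * (qNum q (8 * n + 1) - q ^ (8 * n + 3) * (qNum q (4 * n + 1) ^ 2 / qNum q (8 * n + 4))) := by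
  have e1 : n + (n + 1) = 2 * n + 1 := by ring
  have e2 : qPoch q (q ^ 2) (2 * n) = qPoch q (q ^ 4) n * qPoch (q ^ 3) (q ^ 4) n := by
    rw [qPoch_two_mul]
    ring_nf
  have e3 : 4 * (n + 1) = 4 + 4 * n := by ring
  have e4 : 8 * n + 4 = 4 + 4 * (2 * n) := by ring
  rw [e2, e4]
  simp only [horiz, vert, weight, qNum, e1, e3, ← two_mul]
  simp only [qPoch_pow_succ, qPoch_self_pow_succ]
  have hn := qPoch_ne_zero hq four_ne_zero 4 n
  have hm := qPoch_ne_zero hq four_ne_zero 4 (2 * n)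
  have k0 : 1 - q ≠ 0 := by simpa using one_sub_pow_ne_zero hq one_ne_zero
  have k1 : 1 - q ^ (4 + 4 * n) ≠ 0 := one_sub_pow_ne_zero hq (by omega)
  have k2 : 1 - q ^ (4 + 4 * (2 * n)) ≠ 0 := one_sub_pow_ne_zero hq (by omega)
  have e5 : q ^ (4 * n * (n + 1)) = q ^ (4 * n ^ 2) * (q ^ n) ^ 4 := by ring
  have e6 : q ^ (4 * n * n) = q ^ (4 * n ^ 2) := by ring
  rw [e5, e6]
  generalize q ^ (4 * n ^ 2) = a at *
  generalize hu0 : 1 - q = u0 at *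
  generalize hu1 : 1 - q ^ (4 + 4 * n) = u1 at *
  generalize hu2 : 1 - q ^ (4 + 4 * (2 * n)) = u2 at *
  field_simp
  simp only [← hu2]
  simp only [pow_add, mul_add, pow_mul', pow_one]
  ring

theorem hasSum_step {q : ℂ} (hq : ‖q‖ < 1) :
    HasSum (fun n => horiz q n (n + 1) + vert q n n)
      (qPochInf (q ^ 3) (q ^ 4) * qPochInf (q ^ 5) (q ^ 4) / qPochInf (q ^ 4) (q ^ 4) ^ 2) := by
  have hp : ‖q ^ 4‖ < 1 := norm_pow_lt_one hq four_ne_zero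
  have k0 : 1 - q ≠ 0 := by simpa using one_sub_pow_ne_zero hq one_ne_zero
  have hnum : Tendsto (fun m => qNum q (4 * m)) atTop (𝓝 (1 / (1 - q))) :=
    (tendsto_one_sub_pow hq
      (tendsto_atTop_mono (fun m => by simp only [id]; omega) tendsto_id)).div_const _
  have h := hasSum_staircase hq (F := horiz q) (G := vert q) 1 (fun n m _ => closed hq n m)
    (fun m => by simp [vert, qNum]) (by simp only [one_mul]; exact exists_bound hq fun x => 4 * x.2)
    (by simp only [one_mul]; exact exists_bound hq fun x => 4 * x.1)
    (fun n => (tendsto_weight hq n).mul hnum) (fun n => ?_)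
  · simp only [ite_mul, zero_mul] at h
    rw [tsum_ite_eq] at h
    convert h using 1
    · simp
    · rw [qPochInf_eq_mul q hp, show q * q ^ 4 = q ^ 5 by ring]
      field_simp
  · refine ((tendsto_weight hq n).mul_const (qNum q (4 * n))).trans (le_of_eq ?_)
    rcases eq_or_ne n 0 with rfl | hn
    · simp [qNum]
    · simp [hn]

end SymmForm

/-! ### The form behind the first two series -/

namespace SlopeForm

/-- The common weight.  It is meant for `n ≤ m`; the truncated difference `m - n` makes the values
for `m < n` meaningless, and no statement about the form depends on them except upper bounds. -/
noncomputable def weight (q : ℂ) (n m : ℕ) : ℂ :=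
  (-1) ^ n * q ^ (2 * n ^ 2) * qPoch (q ^ 2) (q ^ 4) n * qPoch (q ^ 2) (q ^ 4) m *
    qPoch q (q ^ 2) (n + m) /
    (qPoch (q ^ 4) (q ^ 4) n ^ 2 * qPoch (q ^ 4) (q ^ 4) (n + m) * qPoch q (q ^ 2) (m - n))

/-- Horizontal part of the form behind the first two series. -/
noncomputable def horiz (q : ℂ) (n m : ℕ) : ℂ := weight q n m * qNum q (6 * n + 2 * m + 1)

/-- Vertical part of the form behind the first two series; it vanishes for `n = 0`. -/
noncomputable def vert (q : ℂ) (n m : ℕ) : ℂ :=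
  -(weight q n m * (q ^ (1 + 2 * (m - n)) * (1 - q ^ (4 * n)) ^ 2 /
    ((1 - q) * (1 - q ^ (1 + 2 * (m - n))))))

/-- Closedness holds where all four edges lie in the region `n ≤ m`. -/
theorem closed {q : ℂ} (hq : ‖q‖ < 1) {n m : ℕ} (h : n + 1 ≤ m) :
    horiz q n (m + 1) - horiz q n m = vert q (n + 1) m - vert q n m := by
  obtain ⟨d, rfl⟩ := Nat.exists_eq_add_of_le h
  have e1 : n + 1 + d + 1 - n = d + 2 := by omega
  have e2 : n + 1 + d - n = d + 1 := by omega
  have e3 : n + 1 + d - (n + 1) = d := by omega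
  have e4 : n + (n + 1 + d) = 2 * n + d + 1 := by ring
  have e5 : n + (n + 1 + d + 1) = 2 * n + d + 1 + 1 := by ring
  have e6 : n + 1 + (n + 1 + d) = 2 * n + d + 1 + 1 := by ring
  have e7 : n + 1 + d = n + d + 1 := by ring
  simp only [horiz, vert, weight, e1, e2, e3, e4, e5, e6]
  simp only [e7, qPoch_pow_succ, qPoch_self_pow_succ, qNum]
  have hn := qPoch_ne_zero hq four_ne_zero 4 n
  have hm := qPoch_ne_zero hq four_ne_zero 4 (2 * n + d)
  have hd := qPoch_ne_zero hq one_ne_zero 2 d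
  have k0 : 1 - q ≠ 0 := by simpa using one_sub_pow_ne_zero hq one_ne_zero
  have k1 : 1 - q ^ (4 + 4 * n) ≠ 0 := one_sub_pow_ne_zero hq (by omega)
  have k2 : 1 - q ^ (4 + 4 * (2 * n + d)) ≠ 0 := one_sub_pow_ne_zero hq (by omega)
  have k3 : 1 - q ^ (4 + 4 * (2 * n + d + 1)) ≠ 0 := one_sub_pow_ne_zero hq (by omega)
  have k4 : 1 - q ^ (1 + 2 * d) ≠ 0 := one_sub_pow_ne_zero hq (by omega)
  have k5 : 1 - q ^ (1 + 2 * (d + 1)) ≠ 0 := one_sub_pow_ne_zero hq (by omega)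
  rw [pow_one] at hd
  have e8 : q ^ (2 * (n + 1) ^ 2) = q ^ (2 * n ^ 2) * (q ^ n) ^ 4 * q ^ 2 := by ring
  rw [e8]
  generalize q ^ (2 * n ^ 2) = a at *
  generalize hu0 : 1 - q = u0 at *
  generalize hu1 : 1 - q ^ (4 + 4 * n) = u1 at *
  generalize hu2 : 1 - q ^ (4 + 4 * (2 * n + d)) = u2 at *
  generalize hu3 : 1 - q ^ (4 + 4 * (2 * n + d + 1)) = u3 at *
  generalize hu4 : 1 - q ^ (1 + 2 * d) = u4 at *
  generalize hu5 : 1 - q ^ (1 + 2 * (d + 1)) = u5 at *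
  field_simp
  simp only [← hu1, ← hu3, ← hu5]
  simp only [pow_add, mul_add, pow_mul', pow_one, mul_one]
  ring

theorem tendsto_weight {q : ℂ} (hq : ‖q‖ < 1) (n : ℕ) : Tendsto (weight q n) atTop
    (𝓝 ((-1) ^ n * q ^ (2 * n ^ 2) * qPoch (q ^ 2) (q ^ 4) n / qPoch (q ^ 4) (q ^ 4) n ^ 2 *
      (qPochInf (q ^ 2) (q ^ 4) / qPochInf (q ^ 4) (q ^ 4)))) := by
  have hp : ‖q ^ 4‖ < 1 := norm_pow_lt_one hq four_ne_zero
  have hp2 : ‖q ^ 2‖ < 1 := norm_pow_lt_one hq two_ne_zero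
  have hz := qPochInf_ne_zero hq four_ne_zero four_ne_zero
  have hz1 : qPochInf q (q ^ 2) ≠ 0 := by
    simpa using qPochInf_ne_zero hq one_ne_zero two_ne_zero
  have h1 := (((tendsto_qPoch (q ^ 2) hp).mul (tendsto_qPoch_add q hp2 n)).div
    ((tendsto_qPoch_add (q ^ 4) hp n).mul
      ((tendsto_qPoch q hp2).comp (tendsto_sub_atTop_nat n))) (mul_ne_zero hz hz1)).const_mul
    ((-1) ^ n * q ^ (2 * n ^ 2) * qPoch (q ^ 2) (q ^ 4) n / qPoch (q ^ 4) (q ^ 4) n ^ 2)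
  rw [mul_div_mul_right _ _ hz1] at h1
  refine h1.congr fun m => ?_
  simp only [weight, Pi.div_apply, Function.comp_apply]
  ring

/-- Boundedness of all factors of `weight` other than `q ^ (2 n ^ 2)`. -/
theorem isBigO_factor {q : ℂ} (hq : ‖q‖ < 1) :
    (fun x : ℕ × ℕ => (-1) ^ x.1 * qPoch (q ^ 2) (q ^ 4) x.1 * qPoch (q ^ 2) (q ^ 4) x.2 *
      qPoch q (q ^ 2) (x.1 + x.2) *
      ((qPoch (q ^ 4) (q ^ 4) x.1)⁻¹ * (qPoch (q ^ 4) (q ^ 4) x.1)⁻¹ *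
        (qPoch (q ^ 4) (q ^ 4) (x.1 + x.2))⁻¹ * (qPoch (q ^ 1) (q ^ 2) (x.2 - x.1))⁻¹)) =O[⊤]
      (fun _ => (1 : ℝ)) := by
  have hp : ‖q ^ 4‖ < 1 := norm_pow_lt_one hq four_ne_zero
  have hp2 : ‖q ^ 2‖ < 1 := norm_pow_lt_one hq two_ne_zero
  have h0 : (fun x : ℕ × ℕ => (-1 : ℂ) ^ x.1) =O[⊤] (fun _ => (1 : ℝ)) :=
    isBigO_top.mpr ⟨1, fun x => by simp⟩
  have hn := isBigO_qPoch_inv hq four_ne_zero four_ne_zero fun x : ℕ × ℕ => x.1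
  have h1 := (((h0.mul (isBigO_qPoch (q ^ 2) hp fun x => x.1)).mul
    (isBigO_qPoch (q ^ 2) hp fun x => x.2)).mul (isBigO_qPoch q hp2 fun x => x.1 + x.2)).mul
    (((hn.mul hn).mul
    (isBigO_qPoch_inv hq four_ne_zero four_ne_zero fun x => x.1 + x.2)).mul
    (isBigO_qPoch_inv hq one_ne_zero two_ne_zero fun x => x.2 - x.1))
  simp only [mul_one] at h1
  exact h1

theorem exists_bound {q : ℂ} (hq : ‖q‖ < 1) {g : ℕ → ℕ → ℂ}
    (hg : (fun x : ℕ × ℕ => g x.1 x.2) =O[⊤] (fun _ => (1 : ℝ))) :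
    ∃ C, ∀ n m, ‖weight q n m * g n m‖ ≤ C * ‖q‖ ^ n := by
  obtain ⟨C, hC⟩ := exists_geometric_bound hq
    (((isBigO_factor hq).mul hg).congr_right fun _ => one_mul 1) (fun n _ => 2 * n ^ 2)
  refine ⟨C, fun n m => ?_⟩
  refine le_of_eq_of_le ?_ (hC n m (by nlinarith))
  congr 1
  simp only [weight, div_eq_mul_inv, mul_inv, sq, pow_one]
  ring

theorem isBigO_vert_factor {q : ℂ} (hq : ‖q‖ < 1) :
    (fun x : ℕ × ℕ => q ^ (1 + 2 * (x.2 - x.1)) * (1 - q ^ (4 * x.1)) ^ 2 /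
      ((1 - q) * (1 - q ^ (1 + 2 * (x.2 - x.1))))) =O[⊤] (fun _ => (1 : ℝ)) := by
  have h1 : Tendsto (fun j => (1 - q ^ (1 + 2 * j))⁻¹) atTop (𝓝 1⁻¹) :=
    (tendsto_one_sub_pow hq (tendsto_atTop_mono (fun j => by simp only [id]; omega)
      tendsto_id)).inv₀ one_ne_zero
  refine ((((isBigO_pow hq fun x : ℕ × ℕ => 1 + 2 * (x.2 - x.1)).mul
    ((isBigO_one_sub_pow hq fun x => 4 * x.1).pow 2)).mul
    (isBigO_one_of_tendsto h1 fun x => x.2 - x.1)).const_mul_left (1 - q)⁻¹).congr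
    (fun x => ?_) fun _ => by norm_num
  simp only [div_eq_mul_inv, mul_inv]
  ring

/-- The staircase sums have the same value for all positive slopes. -/
theorem hasSum_staircase_slope {q : ℂ} (hq : ‖q‖ < 1) {s : ℕ} (hs : 1 ≤ s) :
    HasSum (fun n => horiz q n (s * (n + 1)) + ∑ i ∈ Finset.range s, vert q n (s * n + i))
      ((1 + q) * qPochInf (q ^ 2) (q ^ 4) * qPochInf (q ^ 6) (q ^ 4)
        / qPochInf (q ^ 4) (q ^ 4) ^ 2) := by
  have hp : ‖q ^ 4‖ < 1 := norm_pow_lt_one hq four_ne_zero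
  have k0 : 1 - q ≠ 0 := by simpa using one_sub_pow_ne_zero hq one_ne_zero
  have hnum : ∀ n, Tendsto (fun m => qNum q (6 * n + 2 * m + 1)) atTop (𝓝 (1 / (1 - q))) :=
    fun n => (tendsto_one_sub_pow hq
      (tendsto_atTop_mono (fun m => by simp only [id]; omega) tendsto_id)).div_const _
  have hnumO : (fun x : ℕ × ℕ => qNum q (6 * x.1 + 2 * x.2 + 1)) =O[⊤] (fun _ => (1 : ℝ)) := by
    refine ((isBigO_one_sub_pow hq fun x : ℕ × ℕ => 6 * x.1 + 2 * x.2 + 1).const_mul_left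
      (1 - q)⁻¹).congr_left fun x => ?_
    rw [qNum, div_eq_mul_inv, mul_comm]
  have h := hasSum_staircase hq (F := horiz q) (G := vert q) s
    (fun n m h => closed hq (by nlinarith)) (fun m => by simp [vert])
    ((exists_bound hq hnumO).imp fun C hC n m _ => hC n m)
    ((exists_bound hq (isBigO_vert_factor hq)).imp fun C hC n m _ => by
      rw [vert, norm_neg]; exact hC n m)
    (fun n => (tendsto_weight hq n).mul (hnum n)) (fun n => ?_)
  · rw [tsum_mul_right, tsum_mul_right, GaussForm.tsum_qPoch_div_sq hq] at h
    convert h using 1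
    have h6 := qPochInf_eq_mul (q ^ 2) hp
    rw [← pow_add] at h6
    rw [h6]
    field_simp
    ring
  · have he : Tendsto (fun m => 1 + 2 * (m - n)) atTop atTop :=
      tendsto_atTop_mono (fun m => by omega) (tendsto_sub_atTop_nat n)
    have h1 := (((tendsto_pow_of_tendsto_atTop hq he).mul_const ((1 - q ^ (4 * n)) ^ 2)).div
      ((tendsto_one_sub_pow hq he).const_mul (1 - q)) (by simpa using k0))
    refine ((tendsto_weight hq n).mul h1).neg.trans (le_of_eq ?_)
    simp

/-- A step of slope `1` is a term of the first series. -/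
theorem one_step_eq {q : ℂ} (hq : ‖q‖ < 1) (n : ℕ) : horiz q n (n + 1) + vert q n n =
    (-1) ^ n * q ^ (2 * n ^ 2) * qPoch (q ^ 2) (q ^ 4) n ^ 2 * qPoch q (q ^ 2) (2 * n)
      / (qPoch (q ^ 4) (q ^ 4) n ^ 2 * qPoch (q ^ 4) (q ^ 4) (2 * n))
      * (qNum q (8 * n + 1) + qNum q (4 * n + 1) * (q ^ (4 * n + 1) / (1 + q ^ (4 * n + 2)))) := by
  have e1 : n + (n + 1) = 2 * n + 1 := by ring
  have e2 : n + 1 - n = 0 + 1 := by omega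
  simp only [horiz, vert, weight, qNum, e1, e2, ← two_mul, Nat.sub_self]
  simp only [qPoch_pow_succ, qPoch_self_pow_succ, qPoch_zero]
  have hn := qPoch_ne_zero hq four_ne_zero 4 n
  have hm := qPoch_ne_zero hq four_ne_zero 4 (2 * n)
  have k0 : 1 - q ≠ 0 := by simpa using one_sub_pow_ne_zero hq one_ne_zero
  have k2 : 1 - q ^ (4 + 4 * (2 * n)) ≠ 0 := one_sub_pow_ne_zero hq (by omega)
  have k3 : 1 - q ^ (4 + 4 * (2 * n)) = (1 - q ^ (4 * n + 2)) * (1 + q ^ (4 * n + 2)) := by ring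
  have k4 := left_ne_zero_of_mul (k3 ▸ k2)
  have k5 := right_ne_zero_of_mul (k3 ▸ k2)
  rw [k3]
  simp only [mul_zero, add_zero, pow_one]
  generalize q ^ (2 * n ^ 2) = a at *
  generalize hu0 : 1 - q = u0 at *
  generalize hu1 : 1 - q ^ (4 * n + 2) = u1 at *
  generalize hu2 : 1 + q ^ (4 * n + 2) = u2 at *
  field_simp
  simp only [← hu0, ← hu1, ← hu2]
  simp only [pow_add, mul_add, pow_mul', pow_one]
  ring

/-- A step of slope `2` is a term of the second series. -/
theorem two_step_eq {q : ℂ} (hq : ‖q‖ < 1) (n : ℕ) :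
    horiz q n (2 * (n + 1)) + (vert q n (2 * n) + vert q n (2 * n + 1)) =
    (-1) ^ n * q ^ (2 * n ^ 2) * qPoch (q ^ 2) (q ^ 4) n * qPoch (q ^ 2) (q ^ 4) (2 * n)
        * qPoch q (q ^ 2) (3 * n)
      / (qPoch (q ^ 4) (q ^ 4) n ^ 2 * qPoch (q ^ 4) (q ^ 4) (3 * n) * qPoch q (q ^ 2) n)
      * (qNum q (10 * n + 1)
        + q ^ (6 * n + 1) * qNum q (4 * n + 2) * qNum q (6 * n + 1) / qNum q (12 * n + 4)
        + q ^ (6 * n + 3) * qNum q (6 * n + 1) * qNum q (6 * n + 3) * qNum q (8 * n + 2)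
            * (1 + q ^ (2 * n + 1))
          / (qNum q (12 * n + 4) * qNum q (12 * n + 8))) := by
  have e1 : 2 * (n + 1) = 2 * n + 1 + 1 := by ring
  have e2 : n + 2 * n = 3 * n := by ring
  have e3 : n + (2 * n + 1) = 3 * n + 1 := by ring
  have e4 : n + (2 * n + 1 + 1) = 3 * n + 1 + 1 := by ring
  have e5 : 2 * n - n = n := by omega
  have e6 : 2 * n + 1 - n = n + 1 := by omega
  have e7 : 2 * n + 1 + 1 - n = n + 1 + 1 := by omega
  have e8 : 12 * n + 4 = 4 + 4 * (3 * n) := by ring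
  have e9 : 12 * n + 8 = 4 + 4 * (3 * n + 1) := by ring
  simp only [horiz, vert, weight, qNum, e1, e2, e3, e4, e5, e6, e7, e8, e9]
  simp only [qPoch_pow_succ, qPoch_self_pow_succ]
  have hn := qPoch_ne_zero hq four_ne_zero 4 n
  have hm := qPoch_ne_zero hq four_ne_zero 4 (3 * n)
  have hd := qPoch_ne_zero hq one_ne_zero 2 n
  rw [pow_one] at hd
  have k0 : 1 - q ≠ 0 := by simpa using one_sub_pow_ne_zero hq one_ne_zero
  have k1 : 1 - q ^ (4 + 4 * (3 * n)) ≠ 0 := one_sub_pow_ne_zero hq (by omega)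
  have k2 : 1 - q ^ (4 + 4 * (3 * n + 1)) ≠ 0 := one_sub_pow_ne_zero hq (by omega)
  have k3 : 1 - q ^ (1 + 2 * n) ≠ 0 := one_sub_pow_ne_zero hq (by omega)
  have k4 : 1 - q ^ (1 + 2 * (n + 1)) ≠ 0 := one_sub_pow_ne_zero hq (by omega)
  generalize q ^ (2 * n ^ 2) = a at *
  generalize hu0 : 1 - q = u0 at *
  generalize hu1 : 1 - q ^ (4 + 4 * (3 * n)) = u1 at *
  generalize hu2 : 1 - q ^ (4 + 4 * (3 * n + 1)) = u2 at *
  generalize hu3 : 1 - q ^ (1 + 2 * n) = u3 at *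
  generalize hu4 : 1 - q ^ (1 + 2 * (n + 1)) = u4 at *
  field_simp
  simp only [← hu1, ← hu2, ← hu3, ← hu4]
  simp only [pow_add, mul_add, pow_mul', pow_one, mul_one]
  generalize q ^ n = X at *
  ring

end SlopeForm

/-! ### The three series -/

theorem theorem1 (q : ℂ) (hq : ‖q‖ < 1) :
    HasSum
      (fun n : ℕ =>
        (-1) ^ n * q ^ (2 * n ^ 2) * qPoch (q ^ 2) (q ^ 4) n ^ 2 * qPoch q (q ^ 2) (2 * n)
          / (qPoch (q ^ 4) (q ^ 4) n ^ 2 * qPoch (q ^ 4) (q ^ 4) (2 * n))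
          * (qNum q (8 * n + 1)
            + qNum q (4 * n + 1) * (q ^ (4 * n + 1) / (1 + q ^ (4 * n + 2)))))
      ((1 + q) * qPochInf (q ^ 2) (q ^ 4) * qPochInf (q ^ 6) (q ^ 4)
        / qPochInf (q ^ 4) (q ^ 4) ^ 2)
    ∧ HasSum
      (fun n : ℕ =>
        (-1) ^ n * q ^ (2 * n ^ 2) * qPoch (q ^ 2) (q ^ 4) n * qPoch (q ^ 2) (q ^ 4) (2 * n)
            * qPoch q (q ^ 2) (3 * n)
          / (qPoch (q ^ 4) (q ^ 4) n ^ 2 * qPoch (q ^ 4) (q ^ 4) (3 * n) * qPoch q (q ^ 2) n)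
          * (qNum q (10 * n + 1)
            + q ^ (6 * n + 1) * qNum q (4 * n + 2) * qNum q (6 * n + 1) / qNum q (12 * n + 4)
            + q ^ (6 * n + 3) * qNum q (6 * n + 1) * qNum q (6 * n + 3) * qNum q (8 * n + 2)
                * (1 + q ^ (2 * n + 1))
              / (qNum q (12 * n + 4) * qNum q (12 * n + 8))))
      ((1 + q) * qPochInf (q ^ 2) (q ^ 4) * qPochInf (q ^ 6) (q ^ 4)
        / qPochInf (q ^ 4) (q ^ 4) ^ 2)
    ∧ HasSum
      (fun n : ℕ =>
        q ^ (4 * n ^ 2) * qPoch q (q ^ 2) (2 * n) ^ 2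
          / (qPoch (q ^ 4) (q ^ 4) n ^ 2 * qPoch (q ^ 4) (q ^ 4) (2 * n))
          * (qNum q (8 * n + 1)
            - q ^ (8 * n + 3) * (qNum q (4 * n + 1) ^ 2 / qNum q (8 * n + 4))))
      (qPochInf (q ^ 3) (q ^ 4) * qPochInf (q ^ 5) (q ^ 4) / qPochInf (q ^ 4) (q ^ 4) ^ 2) := by
  refine ⟨?_, ?_, ?_⟩
  · refine (SlopeForm.hasSum_staircase_slope hq le_rfl).congr_fun fun n => ?_
    rw [← SlopeForm.one_step_eq hq n]
    simp
  · refine (SlopeForm.hasSum_staircase_slope (s := 2) hq (by norm_num)).congr_fun fun n => ?_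
    rw [← SlopeForm.two_step_eq hq n]
    simp [Finset.sum_range_succ]
  · exact (SymmForm.hasSum_step hq).congr_fun fun n => (SymmForm.step_eq hq n).symm
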